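/- Let $d\in\mathbb N$, let $H\in\mathbb R^{d\times d}$ be symmetric with an orthonormal basis of eigenvectors $v_1,\dots,v_d$, $Hv_i=\lambda_i v_i$, and let $\rho>0$, $\eta>0$, $\varsigma\neq 0$. Consider the USAM SDE for the quadratic $f(x)=\tfrac12x^\top Hx$ with isotropic noise, $$dX_t=-H(I_d+\rho H)X_t\,dt+(I_d+\rho H)\sqrt\eta\,\varsigma\,dW_t,\qquad X_0 \text{ independent of } W, \tag{1}$$ where $W$ is a standard $d$-dimensional Brownian motion, and the functions $$P_i(x)=\sqrt{\frac{\lambda_i}{\pi\eta\varsigma^2}\,\frac1{1+\rho\lambda_i}}\;\exp\!\Big[-\frac{\lambda_i}{\eta\varsigma^2}\,\frac1{1+\rho\lambda_i}\,x^2\Big],\qquad x\in\mathbb R,\ 1\le i\le d .$$ A probability measure $\nu$ is called \emph{the stationary distribution} of (1) (respectively, of (1) along the direction $v_i$) if, for $Y_t=X_t$ (respectively, $Y_t=\langle v_i,X_t\rangle$): every solution $X$ of (1) with $Y_0\sim\nu$ satisfies $Y_t\sim\nu$ for all $t\ge0$; every solution for which the law of $Y_t$ does not depend on $t$ has $Y_0\sim\nu$;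 and for every solution, whatever the law of $X_0$, $Y_t$ converges in distribution to $\nu$ as $t\to\infty$. 1. If all eigenvalues $\lambda_i$ are positive, then for every $i\in\{1,\dots,d\}$ the function $P_i$ is a probability density, namely that of $\mathcal N\big(0,\tfrac{\eta\varsigma^2(1+\rho\lambda_i)}{2\lambda_i}\big)$, and it is the density of the stationary distribution of (1) along $v_i$. Moreover, the stationary distribution of (1) on $\mathbb R^d$ is the law of $\sum_i Z_iv_i$ with independent $Z_i\sim P_i$. 2. If some eigenvalue is negative, the formula does not, in general, define a probability distribution: if $\lambda_i<0$ and $\rho<-1/\lambda_i$, then no constant multiple of $x\mapsto\exp\big[-\frac{\lambda_i}{\eta\varsigma^2}\frac1{1+\rho\lambda_i}x^2\big]$ is a probability density. 3. If $H$ has a negative eigenvalue, $\lambda_*$ is the largest negative eigenvalue and $\rho>-1/\lambda_*$, then for every $i$ with $\lambda_i\ne0$ the function $P_i$ is again the density of $\mathcal N\big(0,\tfrac{\eta\varsigma^2(1+\rho\lambda_i)}{2\lambda_i}\big)$, and it is the density of the stationary distribution of (1) along $v_i$. If moreover no eigenvalue is zero, the stationary distribution of (1) on $\mathbb R^d$ is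 the law of $\sum_i Z_iv_i$ with independent $Z_i\sim P_i$. -/

import Mathlib

open MeasureTheory ProbabilityTheory Filter Topology
open scoped NNReal ENNReal BoundedContinuousFunction

universe u

noncomputable section

/-- A standard `d`-dimensional Brownian motion: independent standard real Brownian motions
as coordinates. -/
structure IsBrownianMotion {d : ℕ} {Ω : Type u} [MeasurableSpace Ω]
    (W : ℝ≥0 → Ω → EuclideanSpace ℝ (Fin d)) (P : Measure Ω) : Prop where
  measurable : ∀ t, Measurable (W t)
  brownian_coord : ∀ i, IsBrownianReal (fun t ω => W t ω i) P
  indep_coord : iIndepFun (fun (i : Fin d) (ω : Ω) (t : ℝ≥0) => W t ω i) P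

/-- The drift `-H (I + ρ H) x`. -/
def usamDrift {d : ℕ} (H : Matrix (Fin d) (Fin d) ℝ) (ρ : ℝ)
    (x : EuclideanSpace ℝ (Fin d)) : EuclideanSpace ℝ (Fin d) :=
  -(Matrix.toEuclideanCLM (𝕜 := ℝ) (H * (1 + ρ • H)) x)

/-- The constant diffusion matrix `(I + ρ H) √η ς`. -/
def usamDiffusion {d : ℕ} (H : Matrix (Fin d) (Fin d) ℝ) (ρ η ς : ℝ) :
    Matrix (Fin d) (Fin d) ℝ :=
  (Real.sqrt η * ς) • (1 + ρ • H)

/-- `X` is a (weak) solution, driven by the Brownian motion `W` on the probability space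
`(Ω, P)`, of `dX = -H (I + ρ H) X dt + (I + ρ H) √η ς dW`. The initial value is independent of
the noise. The diffusion coefficient is constant, so its stochastic integral up to time `t` is
the coefficient applied to `W t - W 0`, and `W 0 = 0` almost surely. -/
structure IsUSAMSolution {d : ℕ} (H : Matrix (Fin d) (Fin d) ℝ) (ρ η ς : ℝ)
    {Ω : Type u} [MeasurableSpace Ω] (P : Measure Ω)
    (W X : ℝ≥0 → Ω → EuclideanSpace ℝ (Fin d)) : Prop where
  isProbabilityMeasure : IsProbabilityMeasure P
  brownian : IsBrownianMotion W P
  measurable : ∀ t, Measurable (X t)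
  indep_init : IndepFun (X 0) (fun (ω : Ω) (t : ℝ≥0) => W t ω) P
  continuous_paths : ∀ᵐ ω ∂P, Continuous (fun t => X t ω)
  equation : ∀ᵐ ω ∂P, ∀ t : ℝ≥0,
    X t ω = X 0 ω + (∫ s in (0 : ℝ)..(t : ℝ), usamDrift H ρ (X s.toNNReal ω))
      + Matrix.toEuclideanCLM (𝕜 := ℝ) (usamDiffusion H ρ η ς) (W t ω)

/-- `ν` is *the* stationary distribution of the image `π(X)` of the solutions `X` of the SDE:
it is a probability measure, it is invariant under the dynamics, it is the only law that a
solution with time-independent one-time marginals can have, and it is the limit in distribution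
of `π(X t)` as `t → ∞`, whatever the initial law. The choice `π = id` gives the stationary
distribution of the SDE itself; `π = ⟪v, ·⟫` gives the one along the direction `v`. -/
structure IsTheStationaryDistribution {d : ℕ} (H : Matrix (Fin d) (Fin d) ℝ) (ρ η ς : ℝ)
    {F : Type*} [TopologicalSpace F] [MeasurableSpace F]
    (π : EuclideanSpace ℝ (Fin d) → F) (ν : Measure F) : Prop where
  isProbabilityMeasure : IsProbabilityMeasure ν
  invariant : ∀ (Ω : Type u) [MeasurableSpace Ω] (P : Measure Ω)
    (W X : ℝ≥0 → Ω → EuclideanSpace ℝ (Fin d)), IsUSAMSolution H ρ η ς P W X →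
    P.map (fun ω => π (X 0 ω)) = ν → ∀ t, P.map (fun ω => π (X t ω)) = ν
  unique : ∀ (Ω : Type u) [MeasurableSpace Ω] (P : Measure Ω)
    (W X : ℝ≥0 → Ω → EuclideanSpace ℝ (Fin d)), IsUSAMSolution H ρ η ς P W X →
    (∀ t, P.map (fun ω => π (X t ω)) = P.map (fun ω => π (X 0 ω))) →
    P.map (fun ω => π (X 0 ω)) = ν
  limit : ∀ (Ω : Type u) [MeasurableSpace Ω] (P : Measure Ω)
    (W X : ℝ≥0 → Ω → EuclideanSpace ℝ (Fin d)), IsUSAMSolution H ρ η ς P W X →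
    ∀ g : F →ᵇ ℝ, Tendsto (fun t : ℝ≥0 => ∫ ω, g (π (X t ω)) ∂P) atTop (𝓝 (∫ y, g y ∂ν))

/-- The density `√(l/(π η ς²) · 1/(1+ρ l)) · exp(-(l/(η ς²)) · 1/(1+ρ l) · x²)`. -/
def usamDensity (ρ η ς l x : ℝ) : ℝ :=
  Real.sqrt (l / (Real.pi * η * ς ^ 2) * (1 / (1 + ρ * l))) *
    Real.exp (-(l / (η * ς ^ 2) * (1 / (1 + ρ * l)) * x ^ 2))

/-- The measure on `ℝ` with density `usamDensity`. -/
def usamLaw (ρ η ς l : ℝ) : Measure ℝ :=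
  (volume : Measure ℝ).withDensity (fun x => ENNReal.ofReal (usamDensity ρ η ς l x))

/-- The law on `ℝ^d` whose coordinates in the orthonormal basis `v` are independent, the `i`-th
one having law `usamLaw ρ η ς (lam i)`. -/
def usamJointLaw {d : ℕ} (v : OrthonormalBasis (Fin d) ℝ (EuclideanSpace ℝ (Fin d)))
    (lam : Fin d → ℝ) (ρ η ς : ℝ) : Measure (EuclideanSpace ℝ (Fin d)) :=
  (Measure.pi (fun i => usamLaw ρ η ς (lam i))).map (fun y => ∑ i, y i • v i)

end

/-! Along an eigenvector the equation decouples into a scalar Ornstein–Uhlenbeck equation with rate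
`θ = l * (1 + ρ * l)` and noise `σ = √η ς (1 + ρ l)`. When `θ > 0` the initial value is forgotten
like `exp (-θ t)` and the variance tends to `σ² / (2θ) = η ς² (1 + ρ l) / (2l)`, the variance of
`usamLaw`. Positivity of `θ` is the only stability condition: it holds for `l > 0`, and also for `l
< 0` when `1 + ρ l < 0`.

No Itô theory is needed: the diffusion is constant, so variation of constants solves the equation
path by path, the noise term being a Wiener integral written by integration by parts.
`charFun_usamSolution` turns this into `φ_t w = φ_0 (D_t w) * exp (-(q w - q (D_t w)) / 2)`, where
`q` is the limiting variance form (when every `θ` is positive) and `D_t` the damping. From this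
identity `isTheStationaryDistribution_of_charFun` deduces invariance, uniqueness and, by Lévy's
continuity theorem, convergence. -/

/-! ### Pathwise Wiener integrals as limits of sums. -/

/-- Tagged Riemann–Stieltjes sums over uniform partitions of `[0, t]` converge. -/
lemma tendsto_sum_mul_sub_uniform_partition {t : ℝ} (ht : 0 ≤ t) {F G g : ℝ → ℝ}
    (hF : Continuous F) (hG : ∀ s, HasDerivAt G (g s) s) (hg : Continuous g) (ξ : ℕ → ℕ → ℝ)
    (hξ : ∀ n k : ℕ, ξ n k ∈ Set.Icc (k * t / (n + 1 : ℝ)) ((k + 1 : ℕ) * t / (n + 1 : ℝ))) :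
    Tendsto (fun n : ℕ => ∑ k ∈ Finset.range (n + 1),
      F (ξ n k) * (G ((k + 1 : ℕ) * t / (n + 1 : ℝ)) - G (k * t / (n + 1 : ℝ)))) atTop
      (𝓝 (∫ s in (0 : ℝ)..t, F s * g s)) := by
  have hunif : UniformContinuousOn F (Set.Icc 0 t) :=
    isCompact_Icc.uniformContinuousOn_of_continuous hF.continuousOn
  have hI : 0 ≤ ∫ s in (0 : ℝ)..t, |g s| :=
    intervalIntegral.integral_nonneg ht fun _ _ => abs_nonneg _
  set I := ∫ s in (0 : ℝ)..t, |g s|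
  rw [Metric.tendsto_atTop]
  intro ε hε
  -- The total error is at most this modulus times `I`; the `+ 1` keeps the bound strict and the
  -- division legitimate when `I = 0`.
  obtain ⟨δ, hδ, hFδ⟩ := Metric.uniformContinuousOn_iff.1 hunif (ε / (I + 1)) (by positivity)
  obtain ⟨N, hN⟩ := exists_nat_gt (t / δ)
  refine ⟨N, fun n hn => ?_⟩
  have hn0 : (0 : ℝ) < n + 1 := by positivity
  set p : ℕ → ℝ := fun k => k * t / (n + 1 : ℝ) with hp
  have hmesh : t / (n + 1 : ℝ) < δ := by
    rw [div_lt_iff₀ hn0]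
    have : (N : ℝ) ≤ n := by exact_mod_cast hn
    rw [div_lt_iff₀ hδ] at hN
    nlinarith
  have hmono : Monotone p := fun a b hab => by
    simp only [hp]; gcongr
  have hp0 : p 0 = 0 := by simp [hp]
  have hpn : p (n + 1) = t := by simp only [hp]; push_cast; field_simp
  have hstep : ∀ k, p (k + 1) - p k = t / (n + 1 : ℝ) := fun k => by
    simp only [hp]; push_cast; ring
  have hsplit : ∀ f : ℝ → ℝ, Continuous f →
      ∑ k ∈ Finset.range (n + 1), ∫ s in p k..p (k + 1), f s = ∫ s in (0 : ℝ)..t, f s := by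
    intro f hf
    rw [intervalIntegral.sum_integral_adjacent_intervals
      (fun k _ => hf.intervalIntegrable _ _), hp0, hpn]
  rw [Real.dist_eq, ← hsplit (fun s => F s * g s) (hF.mul hg), ← Finset.sum_sub_distrib]
  have hterm : ∀ k ∈ Finset.range (n + 1),
      |F (ξ n k) * (G (p (k + 1)) - G (p k)) - ∫ s in p k..p (k + 1), F s * g s|
        ≤ ∫ s in p k..p (k + 1), ε / (I + 1) * |g s| := by
    intro k hk
    rw [← intervalIntegral.integral_eq_sub_of_hasDerivAt (fun s _ => hG s)
      (hg.intervalIntegrable _ _), ← intervalIntegral.integral_const_mul,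
      ← intervalIntegral.integral_sub (Continuous.intervalIntegrable (by fun_prop) _ _)
        (Continuous.intervalIntegrable (by fun_prop) _ _)]
    refine (intervalIntegral.abs_integral_le_integral_abs (hmono k.le_succ)).trans ?_
    refine intervalIntegral.integral_mono_on (hmono k.le_succ)
      (Continuous.intervalIntegrable (by fun_prop) _ _)
      (Continuous.intervalIntegrable (by fun_prop) _ _) fun s hs => ?_
    rw [← sub_mul, abs_mul]
    gcongr
    have h0 : 0 ≤ p k := hp0 ▸ hmono (Nat.zero_le k)
    have h1 : p (k + 1) ≤ t := hpn ▸ hmono (Nat.succ_le_succ (by simpa [Nat.lt_succ_iff] using hk))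
    have hξk : ξ n k ∈ Set.Icc (p k) (p (k + 1)) := hξ n k
    have := hFδ (ξ n k) ⟨h0.trans hξk.1, hξk.2.trans h1⟩ s ⟨h0.trans hs.1, hs.2.trans h1⟩ (by
      rw [Real.dist_eq]
      refine lt_of_le_of_lt ?_ hmesh
      rw [← hstep k, abs_le]
      constructor <;> linarith [hξk.1, hξk.2, hs.1, hs.2])
    rw [Real.dist_eq] at this
    exact this.le
  calc _ ≤ ∑ k ∈ Finset.range (n + 1), ∫ s in p k..p (k + 1), ε / (I + 1) * |g s| :=
        (Finset.abs_sum_le_sum_abs _ _).trans (Finset.sum_le_sum hterm)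
    _ = ε / (I + 1) * I := by
        rw [hsplit _ (by fun_prop), intervalIntegral.integral_const_mul]
    _ < ε := by
        rw [div_mul_eq_mul_div, div_lt_iff₀ (by positivity)]
        nlinarith

/-- The left-point sums `∑ f (t_k) (w (t_{k+1}) - w (t_k))` converge to the Wiener integral of
the smooth function `f` against the continuous path `w`, expressed through integration by
parts. -/
lemma tendsto_wiener_sum (t : ℝ≥0) {f f' : ℝ → ℝ} (hf : ∀ s, HasDerivAt f (f' s) s)
    (hf' : Continuous f') {w : ℝ≥0 → ℝ} (hw : Continuous w) (hw0 : w 0 = 0) :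
    Tendsto (fun n : ℕ => ∑ k ∈ Finset.range (n + 1), f (k * t / (n + 1 : ℝ)) *
      (w ((k + 1 : ℕ) * t / (n + 1)) - w (k * t / (n + 1)))) atTop
      (𝓝 (f t * w t - ∫ s in (0 : ℝ)..t, f' s * w s.toNNReal)) := by
  -- Summation by parts swaps the roles: the path becomes the integrand and `f` the integrator. Left
  -- tags for `f` turn into right tags for `w`, since `f_k (w_{k+1} - w_k) = (f_{k+1} w_{k+1} - f_k
  -- w_k) - w_{k+1} (f_{k+1} - f_k)`.
  have key := tendsto_sum_mul_sub_uniform_partition t.2 (F := fun s => w s.toNNReal)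
    (by fun_prop) hf hf' (fun n k => (k + 1 : ℕ) * t / (n + 1 : ℝ))
    (fun n k => ⟨by gcongr <;> simp, le_rfl⟩)
  simp_rw [mul_comm (f' _)]
  refine (key.const_sub (f t * w t)).congr fun n => ?_
  have hcast : ∀ k : ℕ, (k * (t : ℝ) / (n + 1 : ℝ)).toNNReal = k * t / (n + 1) := fun k => by
    rw [show (k * (t : ℝ) / (n + 1 : ℝ)) = ((k * t / (n + 1) : ℝ≥0) : ℝ) by push_cast; rfl,
      Real.toNNReal_coe]
  simp only [NNReal.val_eq_coe, hcast]
  have htel := Finset.sum_range_sub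
    (fun k : ℕ => f (k * t / (n + 1 : ℝ)) * w (k * t / (n + 1))) (n + 1)
  have h1 : ((n + 1 : ℕ) : ℝ) * t / (n + 1 : ℝ) = t := by push_cast; field_simp
  have h2 : ((n + 1 : ℕ) : ℝ≥0) * t / (n + 1) = t := by push_cast; field_simp
  simp only [h1, h2, Nat.cast_zero, zero_mul, zero_div, hw0, mul_zero, sub_zero] at htel
  rw [← htel, ← Finset.sum_sub_distrib]
  exact Finset.sum_congr rfl fun k _ => by ring

/-! ### Characteristic functions of Wiener integrals. -/

/-- The characteristic function of a weighted sum of increments of a Brownian motion. -/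
lemma charFun_sum_increments {Ω : Type*} [MeasurableSpace Ω] {P : Measure Ω}
    {B : ℝ≥0 → Ω → ℝ} (hB : IsPreBrownianReal B P) {τ : ℕ → ℝ≥0} (hτ : Monotone τ)
    (a : ℕ → ℝ) (n : ℕ) (r : ℝ) :
    charFun (P.map fun ω => ∑ k ∈ Finset.range n, a k * (B (τ (k + 1)) ω - B (τ k) ω)) r =
      Complex.exp (-((r ^ 2 * ∑ k ∈ Finset.range n, a k ^ 2 * ((τ (k + 1) : ℝ) - τ k) : ℝ) / 2)) := by
  have : IsProbabilityMeasure P := hB.isGaussianProcess.isProbabilityMeasure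
  have hind := (hB.hasIndepIncrements.nat hτ).comp (fun k x => a k * x) (by fun_prop)
  have hmeas : ∀ k, AEMeasurable (fun ω => a k * (B (τ (k + 1)) ω - B (τ k) ω)) P := fun k =>
    ((hB.aemeasurable _).sub (hB.aemeasurable _)).const_mul _
  rw [iIndepFun.charFun_map_fun_finsetSum_eq_prod (fun k _ => hmeas k) (hind.restrict _), Finset.prod_apply,
    Finset.mul_sum, Complex.ofReal_sum, Finset.sum_div, ← Finset.sum_neg_distrib, Complex.exp_sum]
  refine Finset.prod_congr rfl fun k _ => ?_
  rw [charFun_map_mul_comp ((hB.aemeasurable (τ (k + 1))).fun_sub (hB.aemeasurable (τ k)))]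
  have hlaw := (hB.hasLaw_sub (τ (k + 1)) (τ k)).map_eq
  rw [show (fun ω => B (τ (k + 1)) ω - B (τ k) ω) = B (τ (k + 1)) - B (τ k) from rfl, hlaw,
    charFun_gaussianReal]
  have hd : ((nndist (τ (k + 1)).1 (τ k).1 : ℝ≥0) : ℝ) = (τ (k + 1) : ℝ) - τ k := by
    rw [coe_nndist, Real.dist_eq, abs_of_nonneg]
    · rfl
    · exact sub_nonneg.2 (hτ k.le_succ)
  congr 1
  rw [hd]
  push_cast
  ring

lemma charFun_map_inner {Ω E : Type*} [MeasurableSpace Ω] {P : Measure Ω}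
    [NormedAddCommGroup E] [InnerProductSpace ℝ E] [MeasurableSpace E] [BorelSpace E]
    [SecondCountableTopology E] {X : Ω → E} (hX : AEMeasurable X P) (v : E) (r : ℝ) :
    charFun (P.map fun ω => inner ℝ (X ω) v) r = charFun (P.map X) (r • v) := by
  rw [charFun_apply, charFun_apply, integral_map (by fun_prop) (by fun_prop),
    integral_map hX (by fun_prop)]
  simp [inner_smul_right]

/-- The joint characteristic function of an initial value and the increments of an independent
`d`-dimensional Brownian motion. -/
lemma charFun_inner_add_sum_increments {d : ℕ} {Ω : Type u} [MeasurableSpace Ω] {P : Measure Ω}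
    [IsProbabilityMeasure P] {W : ℝ≥0 → Ω → EuclideanSpace ℝ (Fin d)} (hW : IsBrownianMotion W P)
    {X₀ : Ω → EuclideanSpace ℝ (Fin d)} (hX : Measurable X₀)
    (hind : IndepFun X₀ (fun (ω : Ω) (t : ℝ≥0) => W t ω) P)
    (x : EuclideanSpace ℝ (Fin d)) {τ : ℕ → ℝ≥0} (hτ : Monotone τ) (a : Fin d → ℕ → ℝ) (n : ℕ) :
    charFun (P.map fun ω => inner ℝ (X₀ ω) x +
      ∑ j, ∑ k ∈ Finset.range n, a j k * (W (τ (k + 1)) ω j - W (τ k) ω j)) 1 =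
    charFun (P.map X₀) x * Complex.exp (-((∑ j, ∑ k ∈ Finset.range n,
      a j k ^ 2 * ((τ (k + 1) : ℝ) - τ k) : ℝ) / 2)) := by
  have hWm := hW.measurable
  have hindep : IndepFun (fun ω => inner ℝ (X₀ ω) x) (fun ω =>
      ∑ j, ∑ k ∈ Finset.range n, a j k * (W (τ (k + 1)) ω j - W (τ k) ω j)) P :=
    hind.comp (φ := fun y => inner ℝ y x)
      (ψ := fun w : ℝ≥0 → EuclideanSpace ℝ (Fin d) =>
        ∑ j, ∑ k ∈ Finset.range n, a j k * (w (τ (k + 1)) j - w (τ k) j))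
      (by fun_prop) (by fun_prop)
  have hcoord : iIndepFun (fun (j : Fin d) ω =>
      ∑ k ∈ Finset.range n, a j k * (W (τ (k + 1)) ω j - W (τ k) ω j)) P :=
    hW.indep_coord.comp (fun j (w : ℝ≥0 → ℝ) =>
      ∑ k ∈ Finset.range n, a j k * (w (τ (k + 1)) - w (τ k))) (by fun_prop)
  rw [hindep.charFun_map_fun_add_eq_mul (by fun_prop) (by fun_prop), Pi.mul_apply,
    charFun_map_inner hX.aemeasurable, one_smul,
    hcoord.charFun_map_fun_sum_eq_prod (by fun_prop), Finset.prod_apply]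
  congr 1
  simp_rw [charFun_sum_increments (hW.brownian_coord _).toIsPreBrownianReal hτ, ← Complex.exp_sum]
  simp [Finset.sum_div, Finset.sum_neg_distrib]

/-- The joint characteristic function of an initial value and of a Wiener integral with respect
to an independent `d`-dimensional Brownian motion. -/
lemma integral_exp_inner_add_wiener {d : ℕ} {Ω : Type u} [MeasurableSpace Ω] {P : Measure Ω}
    [IsProbabilityMeasure P] {W : ℝ≥0 → Ω → EuclideanSpace ℝ (Fin d)} (hW : IsBrownianMotion W P)
    {X₀ : Ω → EuclideanSpace ℝ (Fin d)} (hX : Measurable X₀)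
    (hind : IndepFun X₀ (fun (ω : Ω) (t : ℝ≥0) => W t ω) P)
    (x : EuclideanSpace ℝ (Fin d)) (t : ℝ≥0) {h h' : Fin d → ℝ → ℝ}
    (hh : ∀ j s, HasDerivAt (h j) (h' j s) s) (hh' : ∀ j, Continuous (h' j)) :
    ∫ ω, Complex.exp ((inner ℝ (X₀ ω) x + ∑ j, (h j t * W t ω j -
      ∫ s in (0 : ℝ)..t, h' j s * W s.toNNReal ω j) : ℝ) * Complex.I) ∂P =
    charFun (P.map X₀) x *
      Complex.exp (-((∑ j, ∫ s in (0 : ℝ)..t, h j s ^ 2 : ℝ) / 2)) := by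
  have hWm := hW.measurable
  have hhc : ∀ j, Continuous (h j) := fun j =>
    continuous_iff_continuousAt.2 fun s => (hh j s).continuousAt
  let τ : ℕ → ℕ → ℝ≥0 := fun n k => k * t / (n + 1)
  have hτ : ∀ n, Monotone (τ n) := fun n a b hab => by
    simp only [τ]; gcongr
  let S : ℕ → Ω → ℝ := fun n ω => inner ℝ (X₀ ω) x + ∑ j, ∑ k ∈ Finset.range (n + 1),
    h j (k * t / (n + 1 : ℝ)) * (W (τ n (k + 1)) ω j - W (τ n k) ω j)
  have hSm : ∀ n, Measurable (S n) := fun n => by fun_prop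
  have hS : ∀ n, ∫ ω, Complex.exp ((S n ω : ℝ) * Complex.I) ∂P = charFun (P.map X₀) x *
      Complex.exp (-((∑ j, ∑ k ∈ Finset.range (n + 1), h j (k * t / (n + 1 : ℝ)) ^ 2 *
        (((k + 1 : ℕ) * t / (n + 1 : ℝ)) - (k * t / (n + 1 : ℝ))) : ℝ) / 2)) := by
    intro n
    have := charFun_inner_add_sum_increments hW hX hind x (hτ n)
      (fun j k => h j (k * t / (n + 1 : ℝ))) (n + 1)
    rw [charFun_apply_real, integral_map (hSm n).aemeasurable (by fun_prop)] at this
    simpa [τ, S] using this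
  have hlim : Tendsto (fun n => ∫ ω, Complex.exp ((S n ω : ℝ) * Complex.I) ∂P) atTop
      (𝓝 (∫ ω, Complex.exp ((inner ℝ (X₀ ω) x + ∑ j, (h j t * W t ω j -
        ∫ s in (0 : ℝ)..t, h' j s * W s.toNNReal ω j) : ℝ) * Complex.I) ∂P)) := by
    -- The integrands have modulus one, so almost sure convergence of the sums is enough and no `L²`
    -- isometry is required.
    refine tendsto_integral_of_dominated_convergence (fun _ => 1) (fun n => ?_)
      (integrable_const _) (fun n => ?_) ?_
    · exact (Complex.measurable_exp.comp (by fun_prop)).aestronglyMeasurable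
    · exact ae_of_all _ fun ω => (Complex.norm_exp_ofReal_mul_I _).le
    · have hc : ∀ᵐ ω ∂P, ∀ j, Continuous (fun t => W t ω j) :=
        ae_all_iff.2 fun j => (hW.brownian_coord j).cont
      have h0 : ∀ᵐ ω ∂P, ∀ j, W 0 ω j = 0 :=
        ae_all_iff.2 fun j => (hW.brownian_coord j).toIsPreBrownianReal.eval_zero_ae_eq_zero
      filter_upwards [hc, h0] with ω hc h0
      have hSω : Tendsto (fun n => S n ω) atTop (𝓝 (inner ℝ (X₀ ω) x + ∑ j, (h j t * W t ω j -
          ∫ s in (0 : ℝ)..t, h' j s * W s.toNNReal ω j))) :=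
        (tendsto_finsetSum _ fun j _ =>
          tendsto_wiener_sum t (hh j) (hh' j) (hc j) (h0 j)).const_add _
      exact (Complex.continuous_exp.tendsto _).comp
        (((Complex.continuous_ofReal.tendsto _).comp hSω).mul_const _)
  refine tendsto_nhds_unique hlim ?_
  simp_rw [hS]
  have hvar : Tendsto (fun n : ℕ => ∑ j, ∑ k ∈ Finset.range (n + 1),
      h j (k * t / (n + 1 : ℝ)) ^ 2 * (((k + 1 : ℕ) * t / (n + 1 : ℝ)) - (k * t / (n + 1 : ℝ))))
      atTop (𝓝 (∑ j, ∫ s in (0 : ℝ)..t, h j s ^ 2)) := by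
    refine tendsto_finsetSum _ fun j _ => ?_
    have := tendsto_sum_mul_sub_uniform_partition t.2 (F := fun s => h j s ^ 2) (G := id)
      (g := fun _ => 1) (by fun_prop) (fun s => hasDerivAt_id s) continuous_const
      (fun n k => k * t / (n + 1 : ℝ)) (fun n k => ⟨le_rfl, by gcongr <;> simp⟩)
    simpa using this
  refine Tendsto.const_mul _ ((Complex.continuous_exp.tendsto _).comp ?_)
  exact (((Complex.continuous_ofReal.tendsto _).comp hvar).div_const 2).neg

/-! ### Solving the equation in the eigenbasis. -/

/-- Variation of constants for the scalar integral equation `y = y₀ - θ ∫ y + b`. -/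
lemma variation_of_constants {θ : ℝ} {y b : ℝ≥0 → ℝ} (hy : Continuous y) (hb : Continuous b)
    (heq : ∀ t : ℝ≥0, y t = y 0 - θ * (∫ s in (0 : ℝ)..t, y s.toNNReal) + b t) (t : ℝ≥0) :
    y t = Real.exp (-θ * t) * y 0 +
      (b t - ∫ s in (0 : ℝ)..t, θ * Real.exp (-θ * (t - s)) * b s.toNNReal) := by
  -- For nonnegative times `z = y - b`, which is differentiable although `y` and `b` need not be.
  -- The derivative of `exp (-θ (t - s)) * z s` is then `-θ exp (-θ (t - s)) * b s`.
  let z : ℝ → ℝ := fun s => y 0 - θ * ∫ r in (0 : ℝ)..s, y r.toNNReal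
  have hyc : Continuous fun s : ℝ => y s.toNNReal := by fun_prop
  have hbc : Continuous fun s : ℝ => b s.toNNReal := by fun_prop
  have hz : ∀ s, HasDerivAt z (-(θ * y s.toNNReal)) s := fun s =>
    ((hyc.integral_hasStrictDerivAt 0 s).hasDerivAt.const_mul θ).const_sub (y 0)
  have he : ∀ s : ℝ, HasDerivAt (fun s : ℝ => Real.exp (-θ * (t - s)))
      (Real.exp (-θ * (t - s)) * θ) s := fun s => by
    simpa using (((hasDerivAt_id s).const_sub (t : ℝ)).const_mul (-θ)).exp
  have hftc := intervalIntegral.integral_eq_sub_of_hasDerivAt (a := 0) (b := t)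
    (fun s _ => (he s).mul (hz s)) (Continuous.intervalIntegrable (by
      have : Continuous z := continuous_iff_continuousAt.2 fun s => (hz s).continuousAt
      fun_prop) _ _)
  have hcongr : ∫ s in (0 : ℝ)..t, (Real.exp (-θ * (t - s)) * θ * z s +
      Real.exp (-θ * (t - s)) * -(θ * y s.toNNReal)) =
      ∫ s in (0 : ℝ)..t, -(θ * Real.exp (-θ * (t - s)) * b s.toNNReal) := by
    refine intervalIntegral.integral_congr fun s hs => ?_
    rw [Set.uIcc_of_le t.coe_nonneg] at hs
    have := heq s.toNNReal
    rw [Real.coe_toNNReal s hs.1] at this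
    simp only [z]
    rw [this]
    ring
  rw [hcongr, intervalIntegral.integral_neg] at hftc
  have hzt : z t = y t - b t := by rw [heq t]; simp only [z]; ring
  have hz0 : z 0 = y 0 := by simp [z]
  simp only [Pi.mul_apply, sub_self, mul_zero, Real.exp_zero, one_mul, sub_zero, hzt, hz0] at hftc
  linarith

section Eigenbasis

variable {d : ℕ} {H : Matrix (Fin d) (Fin d) ℝ}
  {v : OrthonormalBasis (Fin d) ℝ (EuclideanSpace ℝ (Fin d))} {lam : Fin d → ℝ}

lemma inner_eigenvector_toEuclideanCLM (hH : H.IsSymm)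
    (hv : ∀ i, Matrix.toEuclideanCLM (𝕜 := ℝ) H (v i) = lam i • v i) (i : Fin d)
    (x : EuclideanSpace ℝ (Fin d)) :
    inner ℝ (v i) (Matrix.toEuclideanCLM (𝕜 := ℝ) H x) = lam i * inner ℝ (v i) x := by
  have hsymm : H.toEuclideanLin.IsSymmetric :=
    Matrix.isSymmetric_toEuclideanLin_iff.2 (by
      rwa [Matrix.IsHermitian, Matrix.conjTranspose_eq_transpose_of_trivial])
  have := hsymm (v i) x
  rw [← Matrix.coe_toEuclideanCLM_eq_toEuclideanLin] at this
  simp only [ContinuousLinearMap.coe_coe] at this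
  rw [← this, hv, real_inner_smul_left]

lemma inner_eigenvector_one_add_smul (hH : H.IsSymm)
    (hv : ∀ i, Matrix.toEuclideanCLM (𝕜 := ℝ) H (v i) = lam i • v i) (ρ : ℝ) (i : Fin d)
    (x : EuclideanSpace ℝ (Fin d)) :
    inner ℝ (v i) (Matrix.toEuclideanCLM (𝕜 := ℝ) (1 + ρ • H) x) =
      (1 + ρ * lam i) * inner ℝ (v i) x := by
  rw [map_add, map_one, map_smul]
  simp only [add_apply, one_apply_eq_self,
    smul_apply, inner_add_right, real_inner_smul_right,
    inner_eigenvector_toEuclideanCLM hH hv]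
  ring

lemma inner_eigenvector_usamDrift (hH : H.IsSymm)
    (hv : ∀ i, Matrix.toEuclideanCLM (𝕜 := ℝ) H (v i) = lam i • v i) (ρ : ℝ) (i : Fin d)
    (x : EuclideanSpace ℝ (Fin d)) :
    inner ℝ (v i) (usamDrift H ρ x) = -(lam i * (1 + ρ * lam i)) * inner ℝ (v i) x := by
  rw [usamDrift, map_mul, inner_neg_right, mul_apply_eq_comp,
    inner_eigenvector_toEuclideanCLM hH hv, inner_eigenvector_one_add_smul hH hv]
  ring

lemma inner_eigenvector_usamDiffusion (hH : H.IsSymm)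
    (hv : ∀ i, Matrix.toEuclideanCLM (𝕜 := ℝ) H (v i) = lam i • v i) (ρ η ς : ℝ) (i : Fin d)
    (x : EuclideanSpace ℝ (Fin d)) :
    inner ℝ (v i) (Matrix.toEuclideanCLM (𝕜 := ℝ) (usamDiffusion H ρ η ς) x) =
      Real.sqrt η * ς * (1 + ρ * lam i) * inner ℝ (v i) x := by
  rw [usamDiffusion, map_smul, smul_apply, real_inner_smul_right,
    inner_eigenvector_one_add_smul hH hv]
  ring

/-- Along an eigenvector, a solution is an explicit linear functional of its initial value and
of the driving path. -/
lemma inner_eigenvector_solution (hH : H.IsSymm)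
    (hv : ∀ i, Matrix.toEuclideanCLM (𝕜 := ℝ) H (v i) = lam i • v i) {ρ η ς : ℝ}
    {x w : ℝ≥0 → EuclideanSpace ℝ (Fin d)} (hx : Continuous x) (hw : Continuous w)
    (heq : ∀ t : ℝ≥0, x t = x 0 + (∫ s in (0 : ℝ)..(t : ℝ), usamDrift H ρ (x s.toNNReal))
      + Matrix.toEuclideanCLM (𝕜 := ℝ) (usamDiffusion H ρ η ς) (w t)) (t : ℝ≥0) (i : Fin d) :
    inner ℝ (v i) (x t) = Real.exp (-(lam i * (1 + ρ * lam i)) * t) * inner ℝ (v i) (x 0) +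
      Real.sqrt η * ς * (1 + ρ * lam i) * (inner ℝ (v i) (w t) -
        ∫ s in (0 : ℝ)..t, lam i * (1 + ρ * lam i) *
          Real.exp (-(lam i * (1 + ρ * lam i)) * (t - s)) * inner ℝ (v i) (w s.toNNReal)) := by
  have hdrift : Continuous fun s : ℝ => usamDrift H ρ (x s.toNNReal) := by
    unfold usamDrift; fun_prop
  have := variation_of_constants (θ := lam i * (1 + ρ * lam i))
    (y := fun t => inner ℝ (v i) (x t))
    (b := fun t => Real.sqrt η * ς * (1 + ρ * lam i) * inner ℝ (v i) (w t))
    (by fun_prop) (by fun_prop) (fun t => by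
      have hint := (innerSL ℝ (v i)).intervalIntegral_comp_comm
        (hdrift.intervalIntegrable (μ := volume) 0 t)
      simp only [innerSL_apply_apply, inner_eigenvector_usamDrift hH hv,
        intervalIntegral.integral_const_mul] at hint
      conv_lhs => rw [heq t, inner_add_right, inner_add_right, ← hint,
        inner_eigenvector_usamDiffusion hH hv]
      ring) t
  rw [this, mul_sub, ← intervalIntegral.integral_const_mul]
  congr 3
  ext s
  ring

/-- The characteristic function of the solution at time `t`, in terms of the one of its initial
value. -/
lemma charFun_usamSolution (hH : H.IsSymm)
    (hv : ∀ i, Matrix.toEuclideanCLM (𝕜 := ℝ) H (v i) = lam i • v i) {ρ η ς : ℝ}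
    {Ω : Type u} [MeasurableSpace Ω] {P : Measure Ω}
    {W X : ℝ≥0 → Ω → EuclideanSpace ℝ (Fin d)} (hX : IsUSAMSolution H ρ η ς P W X) (t : ℝ≥0)
    (u : EuclideanSpace ℝ (Fin d)) :
    charFun (P.map (X t)) u = charFun (P.map (X 0))
        (∑ i, (Real.exp (-(lam i * (1 + ρ * lam i)) * t) * inner ℝ (v i) u) • v i) *
      Complex.exp (-((∑ i, (inner ℝ (v i) u * (Real.sqrt η * ς * (1 + ρ * lam i))) ^ 2 *
        ∫ s in (0 : ℝ)..t, Real.exp (-(lam i * (1 + ρ * lam i)) * (t - s)) ^ 2 : ℝ) / 2)) := by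
  have := hX.isProbabilityMeasure
  set θ : Fin d → ℝ := fun i => lam i * (1 + ρ * lam i) with hθ
  set c : Fin d → ℝ := fun i => inner ℝ (v i) u * (Real.sqrt η * ς * (1 + ρ * lam i)) with hc
  -- The kernel against the `j`-th standard coordinate of `W`: independence of the noise is given in
  -- the standard basis, whereas the damping is diagonal in the eigenbasis.
  let h : Fin d → ℝ → ℝ := fun j s => ∑ i, c i * v i j * Real.exp (-θ i * (t - s))
  let h' : Fin d → ℝ → ℝ := fun j s => ∑ i, c i * v i j * (θ i * Real.exp (-θ i * (t - s)))
  have hh : ∀ j s, HasDerivAt (h j) (h' j s) s := fun j s => by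
    refine HasDerivAt.fun_sum fun i _ => HasDerivAt.const_mul _ ?_
    simpa [mul_comm] using (((hasDerivAt_id s).const_sub (t : ℝ)).const_mul (-θ i)).exp
  have hh' : ∀ j, Continuous (h' j) := fun j => by fun_prop
  have hinner : ∀ (i : Fin d) (w : EuclideanSpace ℝ (Fin d)),
      inner ℝ (v i) w = ∑ j, v i j * w j := fun i w => by
    simp [PiLp.inner_apply, mul_comm]
  have key := integral_exp_inner_add_wiener hX.brownian (hX.measurable 0) hX.indep_init
    (∑ i, (Real.exp (-θ i * t) * inner ℝ (v i) u) • v i) t hh hh'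
  have hvar : ∑ j, ∫ s in (0 : ℝ)..t, h j s ^ 2 =
      ∑ i, c i ^ 2 * ∫ s in (0 : ℝ)..t, Real.exp (-θ i * (t - s)) ^ 2 := by
    simp_rw [← intervalIntegral.integral_const_mul]
    rw [← intervalIntegral.integral_finsetSum
      fun j _ => Continuous.intervalIntegrable (by fun_prop) _ _,
      ← intervalIntegral.integral_finsetSum
      fun j _ => Continuous.intervalIntegrable (by fun_prop) _ _]
    congr 1
    ext s
    -- Parseval: the squared norm is the same in both bases, so no cross terms between different
    -- eigenvectors survive in the variance.
    have h1 := v.sum_sq_norm_inner_right (∑ i, (c i * Real.exp (-θ i * (t - s))) • v i)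
    rw [EuclideanSpace.norm_sq_eq] at h1
    simp only [Real.norm_eq_abs, sq_abs, v.orthonormal.inner_right_fintype] at h1
    simp_rw [← mul_pow, h1]
    refine Finset.sum_congr rfl fun j _ => ?_
    congr 1
    simp only [h, WithLp.ofLp_sum, WithLp.ofLp_smul, Finset.sum_apply, Pi.smul_apply, smul_eq_mul]
    exact Finset.sum_congr rfl fun i _ => by ring
  rw [hvar] at key
  rw [← key, charFun_apply, integral_map (hX.measurable t).aemeasurable (by fun_prop)]
  refine integral_congr_ae ?_
  have hWc : ∀ᵐ ω ∂P, ∀ j, Continuous (fun t => W t ω j) :=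
    ae_all_iff.2 fun j => (hX.brownian.brownian_coord j).cont
  filter_upwards [hX.continuous_paths, hX.equation, hWc] with ω hXω heq hWω
  have hWω' : Continuous fun t => W t ω := (PiLp.continuous_toLp 2 _).comp (continuous_pi hWω)
  have hsol := inner_eigenvector_solution hH hv hXω hWω' heq t
  congr 3
  rw [← v.sum_inner_mul_inner (X t ω) u, inner_sum]
  have hnoise : ∑ j, (h j t * W t ω j - ∫ s in (0 : ℝ)..t, h' j s * W s.toNNReal ω j) =
      ∑ i, c i * (inner ℝ (v i) (W t ω) - ∫ s in (0 : ℝ)..t,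
        θ i * Real.exp (-θ i * (t - s)) * inner ℝ (v i) (W s.toNNReal ω)) := by
    simp only [mul_sub (c _), Finset.sum_sub_distrib, ← intervalIntegral.integral_const_mul]
    rw [← intervalIntegral.integral_finsetSum
      fun j _ => Continuous.intervalIntegrable (by fun_prop) _ _,
      ← intervalIntegral.integral_finsetSum
      fun j _ => Continuous.intervalIntegrable (by fun_prop) _ _]
    congr 1
    · simp only [h, sub_self, mul_zero, Real.exp_zero, mul_one, hinner, Finset.sum_mul,
        Finset.mul_sum]
      rw [Finset.sum_comm]
      exact Finset.sum_congr rfl fun i _ => Finset.sum_congr rfl fun j _ => by ring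
    · congr 1
      ext s
      simp only [h', hinner, Finset.sum_mul, Finset.mul_sum]
      rw [Finset.sum_comm]
      exact Finset.sum_congr rfl fun i _ => Finset.sum_congr rfl fun j _ => by ring
  rw [hnoise, ← Finset.sum_add_distrib]
  refine Finset.sum_congr rfl fun i _ => ?_
  rw [real_inner_comm (v i) (X t ω), hsol i, real_inner_smul_right, real_inner_comm (v i) (X 0 ω)]
  simp only [hc, hθ]
  ring

end Eigenbasis

/-! ### From characteristic functions to the stationary distribution. -/

/-- A law whose characteristic function is `exp (-q / 2)` is the stationary distribution as soon
as the characteristic functions of the solutions evolve by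
`φ_t (w) = φ_0 (D_t w) exp (-(q w - q (D_t w)) / 2)` for a contraction `D_t`. -/
lemma isTheStationaryDistribution_of_charFun {d : ℕ} {H : Matrix (Fin d) (Fin d) ℝ} {ρ η ς : ℝ}
    {F : Type*} [NormedAddCommGroup F] [InnerProductSpace ℝ F] [FiniteDimensional ℝ F]
    [MeasurableSpace F] [BorelSpace F] {π : EuclideanSpace ℝ (Fin d) → F} (hπ : Measurable π)
    {ν : Measure F} [IsProbabilityMeasure ν] {q : F → ℝ} (hq : Continuous q) (hq0 : q 0 = 0)
    {D : ℝ≥0 → F → F} (hD : ∀ w, Tendsto (fun t => D t w) atTop (𝓝 0))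
    (hν : ∀ w, charFun ν w = Complex.exp (-((q w : ℝ) / 2)))
    (hsol : ∀ (Ω : Type u) [MeasurableSpace Ω] (P : Measure Ω)
      (W X : ℝ≥0 → Ω → EuclideanSpace ℝ (Fin d)), IsUSAMSolution H ρ η ς P W X → ∀ t w,
      charFun (P.map fun ω => π (X t ω)) w = charFun (P.map fun ω => π (X 0 ω)) (D t w) *
        Complex.exp (-((q w - q (D t w) : ℝ) / 2))) :
    IsTheStationaryDistribution.{u} H ρ η ς π ν := by
  have : CompleteSpace F := FiniteDimensional.complete ℝ F
  have hprob : ∀ (Ω : Type u) [MeasurableSpace Ω] (P : Measure Ω)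
      (W X : ℝ≥0 → Ω → EuclideanSpace ℝ (Fin d)), IsUSAMSolution H ρ η ς P W X →
      ∀ t, IsProbabilityMeasure (P.map fun ω => π (X t ω)) := fun Ω _ P W X hX t => by
    have := hX.isProbabilityMeasure
    exact Measure.isProbabilityMeasure_map (hπ.comp (hX.measurable t)).aemeasurable
  have hlim : ∀ (Ω : Type u) [MeasurableSpace Ω] (P : Measure Ω)
      (W X : ℝ≥0 → Ω → EuclideanSpace ℝ (Fin d)), IsUSAMSolution H ρ η ς P W X → ∀ w,
      Tendsto (fun t => charFun (P.map fun ω => π (X t ω)) w) atTop (𝓝 (charFun ν w)) := by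
    intro Ω _ P W X hX w
    have := hprob Ω P W X hX 0
    simp_rw [hsol Ω P W X hX _ w]
    have h1 := (continuous_charFun (μ := P.map fun ω => π (X 0 ω))).continuousAt.tendsto.comp
      (hD w)
    have h2 : Tendsto (fun t => Complex.exp (-((q w - q (D t w) : ℝ) / 2))) atTop
        (𝓝 (Complex.exp (-((q w - q 0 : ℝ) / 2)))) := by
      have hcont : Continuous fun y => Complex.exp (-((q w - q y : ℝ) / 2)) := by fun_prop
      exact (hcont.tendsto 0).comp (hD w)
    simpa [hq0, hν w] using h1.mul h2
  refine ⟨inferInstance, fun Ω _ P W X hX h0 t => ?_, fun Ω _ P W X hX hst => ?_,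
    fun Ω _ P W X hX g => ?_⟩
  · have := hprob Ω P W X hX t
    refine Measure.ext_of_charFun (funext fun w => ?_)
    -- Starting from `ν`, the two exponents `q (D t w)` and `q w - q (D t w)` add up to `q w`.
    rw [hsol Ω P W X hX, h0, hν, hν, ← Complex.exp_add]
    congr 1
    push_cast
    ring
  · have := hprob Ω P W X hX 0
    refine Measure.ext_of_charFun (funext fun w => ?_)
    refine tendsto_nhds_unique ?_ (hlim Ω P W X hX w)
    simp_rw [hst]
    exact tendsto_const_nhds
  · have hp := hprob Ω P W X hX
    -- Lévy's theorem is applied along an arbitrary sequence of times tending to infinity.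
    refine tendsto_of_seq_tendsto fun τ hτ => ?_
    let μ : ℕ → ProbabilityMeasure F := fun n => ⟨P.map fun ω => π (X (τ n) ω), hp _⟩
    let ν' : ProbabilityMeasure F := ⟨ν, inferInstance⟩
    have h1 : Tendsto μ atTop (𝓝 ν') :=
      ProbabilityMeasure.tendsto_iff_tendsto_charFun.2 fun w => (hlim Ω P W X hX w).comp hτ
    have h2 := ProbabilityMeasure.tendsto_iff_forall_integral_tendsto.1 h1 g
    refine h2.congr fun n => ?_
    exact integral_map (hπ.comp (hX.measurable _)).aemeasurable
      g.continuous.aestronglyMeasurable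

/-- Multiplied by `σ²`, the term `1` gives the limiting variance and the term `exp (-θ t) ^ 2` its
damped copy; these become `q w` and `q (D t w)`. -/
lemma integral_exp_neg_mul_sub_sq {θ : ℝ} (hθ : θ ≠ 0) (t : ℝ) :
    ∫ s in (0 : ℝ)..t, Real.exp (-θ * (t - s)) ^ 2 = (1 - Real.exp (-θ * t) ^ 2) / (2 * θ) := by
  have h : ∀ s : ℝ, HasDerivAt (fun s => Real.exp (-θ * (t - s)) ^ 2 / (2 * θ))
      (Real.exp (-θ * (t - s)) ^ 2) s := fun s => by
    have := ((((hasDerivAt_id s).const_sub t).const_mul (-θ)).exp.pow 2).div_const (2 * θ)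
    refine this.congr_deriv ?_
    simp
    field_simp
  rw [intervalIntegral.integral_eq_sub_of_hasDerivAt (fun s _ => h s)
    (Continuous.intervalIntegrable (by fun_prop) _ _)]
  simp
  ring

lemma usamLaw_eq_gaussianReal {ρ η ς l : ℝ} (hη : 0 < η) (hς : ς ≠ 0)
    (hl : 0 < l * (1 + ρ * l)) :
    usamLaw ρ η ς l = gaussianReal 0 (Real.toNNReal (η * ς ^ 2 * (1 + ρ * l) / (2 * l))) := by
  have hl0 : l ≠ 0 := by rintro rfl; simp at hl
  have h1 : 1 + ρ * l ≠ 0 := fun h => by simp [h] at hl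
  have hς2 : 0 < ς ^ 2 := by positivity
  have hpos : 0 < η * ς ^ 2 * (1 + ρ * l) / (2 * l) := by
    -- Only the product `l * (1 + ρ * l)` is known to be positive; both factors may be negative.
    rw [show η * ς ^ 2 * (1 + ρ * l) / (2 * l) = η * ς ^ 2 * (l * (1 + ρ * l)) / (2 * l ^ 2) by
      field_simp]
    positivity
  rw [gaussianReal_of_var_ne_zero _ (by simpa using hpos), usamLaw]
  congr 1
  ext x
  rw [gaussianPDF, gaussianPDFReal, usamDensity, Real.coe_toNNReal _ hpos.le, ← Real.sqrt_inv]
  congr 3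
  · field_simp
  · field_simp
    ring

/-- `x ↦ c exp (b x²)` with `b ≥ 0` is not a probability density. -/
lemma not_isProbabilityMeasure_withDensity_exp {b : ℝ} (hb : 0 ≤ b) (c : ℝ) :
    ¬ IsProbabilityMeasure ((volume : Measure ℝ).withDensity
      (fun x => ENNReal.ofReal (c * Real.exp (b * x ^ 2)))) := by
  intro h
  have h1 := h.measure_univ
  rw [withDensity_apply _ MeasurableSet.univ, setLIntegral_univ] at h1
  rcases le_or_gt c 0 with hc | hc
  -- `ENNReal.ofReal` truncates a nonpositive density to zero, leaving total mass `0`; for `c > 0`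
  -- the density is at least `c`, so the mass is infinite.
  · have : ∀ x : ℝ, ENNReal.ofReal (c * Real.exp (b * x ^ 2)) = 0 := fun x =>
      ENNReal.ofReal_of_nonpos (mul_nonpos_of_nonpos_of_nonneg hc (Real.exp_pos _).le)
    simp [this] at h1
  · have hle : ∫⁻ _ : ℝ, ENNReal.ofReal c ≤
        ∫⁻ x : ℝ, ENNReal.ofReal (c * Real.exp (b * x ^ 2)) := by
      refine lintegral_mono fun x => ENNReal.ofReal_le_ofReal ?_
      exact le_mul_of_one_le_right hc.le (Real.one_le_exp (by positivity))
    rw [h1, lintegral_const, Real.volume_univ, ENNReal.mul_top (by simpa using hc)] at hle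
    simp at hle

/-! ### The Gaussian laws along eigenvectors and on the whole space. -/

section Eigenbasis

variable {d : ℕ} {H : Matrix (Fin d) (Fin d) ℝ}
  {v : OrthonormalBasis (Fin d) ℝ (EuclideanSpace ℝ (Fin d))} {lam : Fin d → ℝ} {ρ η ς : ℝ}

/-- The variance is put in the form `σ² / (2θ)`, in which it comes out of the solution formula. -/
lemma charFun_usamLaw {l : ℝ} (hη : 0 < η) (hς : ς ≠ 0) (hl : 0 < l * (1 + ρ * l)) (r : ℝ) :
    charFun (usamLaw ρ η ς l) r =
      Complex.exp (-((r ^ 2 * ((Real.sqrt η * ς * (1 + ρ * l)) ^ 2 / (2 * (l * (1 + ρ * l)))) : ℝ)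
        / 2)) := by
  have hl0 : l ≠ 0 := by rintro rfl; simp at hl
  have h1 : 1 + ρ * l ≠ 0 := fun h => by simp [h] at hl
  have heq : (Real.sqrt η * ς * (1 + ρ * l)) ^ 2 / (2 * (l * (1 + ρ * l))) =
      η * ς ^ 2 * (1 + ρ * l) / (2 * l) := by
    rw [mul_pow, mul_pow, Real.sq_sqrt hη.le]
    field_simp
  have hnn : 0 ≤ η * ς ^ 2 * (1 + ρ * l) / (2 * l) := heq ▸ by positivity
  rw [usamLaw_eq_gaussianReal hη hς hl, charFun_gaussianReal, Real.coe_toNNReal _ hnn, heq]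
  congr 1
  push_cast
  ring

lemma tendsto_exp_neg_mul_coe_atTop {θ : ℝ} (hθ : 0 < θ) :
    Tendsto (fun t : ℝ≥0 => Real.exp (-θ * t)) atTop (𝓝 0) := by
  refine Real.tendsto_exp_atBot.comp ?_
  exact (NNReal.tendsto_coe_atTop.2 tendsto_id).const_mul_atTop_of_neg (neg_lt_zero.2 hθ)

/-- Testing the `d`-dimensional formula on `u = r • v i` collapses every sum to index `i`. Nothing
is asked of the other eigenvalues, so zero ones are allowed there. -/
lemma isTheStationaryDistribution_eigenvector (hH : H.IsSymm)
    (hv : ∀ i, Matrix.toEuclideanCLM (𝕜 := ℝ) H (v i) = lam i • v i) (hη : 0 < η) (hς : ς ≠ 0)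
    {i : Fin d} (hl : 0 < lam i * (1 + ρ * lam i)) :
    IsTheStationaryDistribution.{u} H ρ η ς (fun x => inner ℝ (v i) x)
      (usamLaw ρ η ς (lam i)) := by
  have : IsProbabilityMeasure (usamLaw ρ η ς (lam i)) := by
    rw [usamLaw_eq_gaussianReal hη hς hl]; infer_instance
  refine isTheStationaryDistribution_of_charFun (by fun_prop)
    (D := fun t r => Real.exp (-(lam i * (1 + ρ * lam i)) * t) * r) (by fun_prop) (by simp)
    (fun r => by simpa using (tendsto_exp_neg_mul_coe_atTop hl).mul_const r)
    (charFun_usamLaw hη hς hl) fun Ω _ P W X hX t r => ?_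
  have hinner : ∀ s r, charFun (P.map fun ω => inner ℝ (v i) (X s ω)) r =
      charFun (P.map (X s)) (r • v i) := fun s r => by
    simp_rw [real_inner_comm _ (v i)]
    exact charFun_map_inner (hX.measurable s).aemeasurable (v i) r
  rw [hinner, hinner, charFun_usamSolution hH hv hX]
  have hcoord : ∀ k, inner ℝ (v k) (r • v i) = if k = i then r else 0 := fun k => by
    simp [real_inner_smul_right, orthonormal_iff_ite.1 v.orthonormal]
  simp only [hcoord, mul_ite, mul_zero, ite_mul, zero_mul, ite_smul, zero_smul, ite_pow,
    Finset.sum_ite_eq', Finset.mem_univ, if_true, ne_eq, OfNat.ofNat_ne_zero, not_false_eq_true,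
    zero_pow]
  rw [integral_exp_neg_mul_sub_sq hl.ne']
  congr 5
  ring

lemma charFun_usamJointLaw (hη : 0 < η) (hς : ς ≠ 0) (hl : ∀ i, 0 < lam i * (1 + ρ * lam i))
    (u : EuclideanSpace ℝ (Fin d)) :
    charFun (usamJointLaw v lam ρ η ς) u = Complex.exp (-((∑ i, inner ℝ (v i) u ^ 2 *
      ((Real.sqrt η * ς * (1 + ρ * lam i)) ^ 2 / (2 * (lam i * (1 + ρ * lam i)))) : ℝ) / 2)) := by
  have : ∀ i, IsProbabilityMeasure (usamLaw ρ η ς (lam i)) := fun i => by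
    rw [usamLaw_eq_gaussianReal hη hς (hl i)]; infer_instance
  rw [usamJointLaw, charFun_apply, integral_map (Measurable.aemeasurable (by fun_prop))
    (by fun_prop)]
  simp only [sum_inner, real_inner_smul_left, Complex.ofReal_sum, Finset.sum_mul, Complex.exp_sum]
  -- Independence of the eigencoordinates: the integral over the product measure factorizes.
  rw [integral_fintype_prod_eq_prod
    (fun i (y : ℝ) => Complex.exp ((y * inner ℝ (v i) u : ℝ) * Complex.I)),
    Finset.sum_div, ← Finset.sum_neg_distrib, Complex.exp_sum]
  refine Finset.prod_congr rfl fun i _ => ?_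
  rw [← charFun_usamLaw hη hς (hl i), charFun_apply_real]
  simp [mul_comm]

lemma isTheStationaryDistribution_usamJointLaw (hH : H.IsSymm)
    (hv : ∀ i, Matrix.toEuclideanCLM (𝕜 := ℝ) H (v i) = lam i • v i) (hη : 0 < η) (hς : ς ≠ 0)
    (hl : ∀ i, 0 < lam i * (1 + ρ * lam i)) :
    IsTheStationaryDistribution.{u} H ρ η ς id (usamJointLaw v lam ρ η ς) := by
  have : ∀ i, IsProbabilityMeasure (usamLaw ρ η ς (lam i)) := fun i => by
    rw [usamLaw_eq_gaussianReal hη hς (hl i)]; infer_instance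
  have : IsProbabilityMeasure (usamJointLaw v lam ρ η ς) :=
    Measure.isProbabilityMeasure_map (Measurable.aemeasurable (by fun_prop))
  refine isTheStationaryDistribution_of_charFun measurable_id
    (D := fun t u => ∑ i, (Real.exp (-(lam i * (1 + ρ * lam i)) * t) * inner ℝ (v i) u) • v i)
    (by fun_prop) (by simp) (fun u => ?_) (charFun_usamJointLaw hη hς hl)
    fun Ω _ P W X hX t u => ?_
  · rw [show (0 : EuclideanSpace ℝ (Fin d)) = ∑ _i : Fin d, 0 by simp]
    refine tendsto_finsetSum _ fun i _ => ?_
    simpa using ((tendsto_exp_neg_mul_coe_atTop (hl i)).mul_const (inner ℝ (v i) u)).smul_const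
      (v i)
  · refine (charFun_usamSolution hH hv hX t u).trans ?_
    simp only [id_eq]
    congr 5
    rw [← Finset.sum_sub_distrib]
    refine Finset.sum_congr rfl fun i _ => ?_
    rw [integral_exp_neg_mul_sub_sq (hl i).ne', v.orthonormal.inner_right_fintype]
    ring

end Eigenbasis

theorem mainTheorem10 (d : ℕ) (H : Matrix (Fin d) (Fin d) ℝ) (hH : H.IsSymm)
    (v : OrthonormalBasis (Fin d) ℝ (EuclideanSpace ℝ (Fin d))) (lam : Fin d → ℝ)
    (hv : ∀ i, Matrix.toEuclideanCLM (𝕜 := ℝ) H (v i) = lam i • v i)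
    (ρ η ς : ℝ) (hρ : 0 < ρ) (hη : 0 < η) (hς : ς ≠ 0) :
    -- all eigenvalues positive
    ((∀ i, 0 < lam i) →
      (∀ i, usamLaw ρ η ς (lam i) =
            gaussianReal 0 (Real.toNNReal (η * ς ^ 2 * (1 + ρ * lam i) / (2 * lam i))) ∧
          IsTheStationaryDistribution.{u} H ρ η ς (fun x => inner ℝ (v i) x)
            (usamLaw ρ η ς (lam i))) ∧
        IsTheStationaryDistribution.{u} H ρ η ς id (usamJointLaw v lam ρ η ς)) ∧
    -- with a negative eigenvalue the formula can fail to be normalizable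
    (∀ i, lam i < 0 → ρ < -1 / lam i → ∀ c : ℝ,
      ¬ IsProbabilityMeasure ((volume : Measure ℝ).withDensity (fun x => ENNReal.ofReal
        (c * Real.exp (-(lam i / (η * ς ^ 2) * (1 / (1 + ρ * lam i)) * x ^ 2)))))) ∧
    -- a negative eigenvalue, and `ρ` beyond the threshold given by the largest negative one
    (∀ lamStar : ℝ, IsGreatest {l : ℝ | l < 0 ∧ ∃ i, lam i = l} lamStar → -1 / lamStar < ρ →
      (∀ i, lam i ≠ 0 →
          usamLaw ρ η ς (lam i) =
            gaussianReal 0 (Real.toNNReal (η * ς ^ 2 * (1 + ρ * lam i) / (2 * lam i))) ∧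
          IsTheStationaryDistribution.{u} H ρ η ς (fun x => inner ℝ (v i) x)
            (usamLaw ρ η ς (lam i))) ∧
        ((∀ i, lam i ≠ 0) →
          IsTheStationaryDistribution.{u} H ρ η ς id (usamJointLaw v lam ρ η ς))) := by
  have hpos : ∀ l, 0 < l → 0 < l * (1 + ρ * l) := fun l hl => by positivity
  refine ⟨fun h => ⟨fun i => ⟨usamLaw_eq_gaussianReal hη hς (hpos _ (h i)),
    isTheStationaryDistribution_eigenvector hH hv hη hς (hpos _ (h i))⟩,
    isTheStationaryDistribution_usamJointLaw hH hv hη hς fun i => hpos _ (h i)⟩,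
    fun i hi hρi c => ?_, fun l hl hρl => ?_⟩
  -- Below the threshold `1 + ρ l > 0` while `l < 0`, so the coefficient of `x²` in the exponent is
  -- nonnegative.
  · have h1 : 0 < 1 + ρ * lam i := by
      rw [lt_div_iff_of_neg hi] at hρi
      linarith
    have hb : 0 ≤ -(lam i / (η * ς ^ 2) * (1 / (1 + ρ * lam i))) := by
      rw [neg_nonneg]
      exact mul_nonpos_of_nonpos_of_nonneg
        (div_nonpos_of_nonpos_of_nonneg hi.le (by positivity)) (by positivity)
    simpa only [neg_mul] using not_isProbabilityMeasure_withDensity_exp hb c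
  · have hall : ∀ i, lam i ≠ 0 → 0 < lam i * (1 + ρ * lam i) := fun i hi => by
      rcases lt_or_gt_of_ne hi with hneg | hp
      -- The largest negative eigenvalue is the binding one: `ρ * lam i ≤ ρ * l < -1`, so both
      -- factors of the rate are negative.
      · have hle : lam i ≤ l := hl.2 ⟨hneg, i, rfl⟩
        have hl0 : l < 0 := hl.1.1
        rw [div_lt_iff_of_neg hl0] at hρl
        exact mul_pos_of_neg_of_neg hneg (by nlinarith)
      · exact hpos _ hp
    exact ⟨fun i hi => ⟨usamLaw_eq_gaussianReal hη hς (hall i hi),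
      isTheStationaryDistribution_eigenvector hH hv hη hς (hall i hi)⟩,
      fun h => isTheStationaryDistribution_usamJointLaw hH hv hη hς fun i => hall i (h i)⟩
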